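/- Let $\mathbb{F}_q$ be a finite field with $q$ elements, let $K=\mathbb{F}_q(\theta)$ be the rational function field with the absolute value $|\cdot|_\infty$ normalized by $|\theta|_\infty=q$, let $K_\infty$ be the completion of $K$ with respect to $|\cdot|_\infty$, let $\mathbb{C}_\infty$ be the completion of an algebraic closure of $K_\infty$, and let $\bar K$ be the algebraic closure of $K$ inside $\mathbb{C}_\infty$. Let $\lambda_\theta\in\mathbb{C}_\infty$ be any $(q-1)$-th root of $-\theta$, put $$\Omega(t)=\lambda_\theta^{-q}\prod_{j\ge 1}\Bigl(1-\frac{t}{\theta^{q^j}}\Bigr)\in\mathbb{C}_\infty[\![t]\!]$$ (the product converging coefficientwise), and let $$\omega(t)=\frac{1}{(t-\theta)\,\Omega(t)}\in\mathbb{C}_\infty(\!(t)\!)$$ be the Anderson–Thakur function. For $n\ge 0$ let $\partial^{(n)}$ be the $n$-th hyperdifferential operator with respect to $t$ on $\mathbb{C}_\infty(\!(t)\!)$, $$\partial^{(n)}\Bigl(\sum_{i\ge i_0} x_i t^i\Bigr)=\sum_{i\ge i_0}\binom{i}{n}x_i t^{i-n}.$$ Then $\omega$ is hypertranscendental over $\bar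 K(t)$: the family $(\partial^{(n)}\omega)_{n\ge 0}$ is algebraically independent over the subfield $\bar K(t)$ of $\mathbb{C}_\infty(\!(t)\!)$. -/

import Mathlib

noncomputable section

namespace AndersonThakur

section Field

variable (F : Type*) [Field F] [Finite F]

/-- The absolute value `|·|_∞` on `K = F(θ)`, `θ = RatFunc.X`: `|0| = 0` and
`|f / g| = q ^ (deg f - deg g)` with `q = #F`. In particular `|θ| = q`. -/
def absInfty : AbsoluteValue (RatFunc F) ℝ := by
  classical
  exact
  { toFun := fun r => if r = 0 then 0 else (Nat.card F : ℝ) ^ r.intDegree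
    map_mul' := by
      have hq : (Nat.card F : ℝ) ≠ 0 := Nat.cast_ne_zero.2 Nat.card_pos.ne'
      intro x y
      by_cases hx : x = 0
      · simp [hx]
      by_cases hy : y = 0
      · simp [hy]
      simp [hx, hy, RatFunc.intDegree_mul hx hy, zpow_add₀ hq]
    nonneg' := by
      intro x
      split_ifs <;> positivity
    eq_zero' := by
      have hq : (Nat.card F : ℝ) ≠ 0 := Nat.cast_ne_zero.2 Nat.card_pos.ne'
      intro x
      split_ifs with h
      · simp [h]
      · simp [h, zpow_ne_zero _ hq]
    add_le' := by
      have hq : (1 : ℝ) ≤ Nat.card F := Nat.one_le_cast.2 Nat.card_pos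
      intro x y
      by_cases hx : x = 0
      · simp [hx]
      by_cases hy : y = 0
      · simp [hy]
      by_cases hxy : x + y = 0
      · simp only [hxy, hx, hy, if_true, if_false]
        positivity
      simp only [hxy, hx, hy, if_false]
      have h0 : (0 : ℝ) ≤ (Nat.card F : ℝ) ^ x.intDegree := by positivity
      have h1 : (0 : ℝ) ≤ (Nat.card F : ℝ) ^ y.intDegree := by positivity
      rcases le_max_iff.1 (RatFunc.intDegree_add_le hy hxy) with h | h
      · linarith [zpow_le_zpow_right₀ hq h]
      · linarith [zpow_le_zpow_right₀ hq h] }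

theorem absInfty_of_ne_zero {r : RatFunc F} (hr : r ≠ 0) :
    absInfty F r = (Nat.card F : ℝ) ^ r.intDegree := by
  classical
  exact if_neg hr

theorem absInfty_X : absInfty F RatFunc.X = Nat.card F := by
  rw [absInfty_of_ne_zero F RatFunc.X_ne_zero, RatFunc.intDegree_X, zpow_one]

theorem absInfty_add_le_max (x y : RatFunc F) :
    absInfty F (x + y) ≤ max (absInfty F x) (absInfty F y) := by
  have hq : (1 : ℝ) ≤ Nat.card F := Nat.one_le_cast.2 Nat.card_pos
  by_cases hx : x = 0
  · simp [hx]
  by_cases hy : y = 0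
  · simp [hy]
  by_cases hxy : x + y = 0
  · rw [hxy, map_zero]
    exact le_max_of_le_left ((absInfty F).nonneg x)
  rw [absInfty_of_ne_zero F hxy, absInfty_of_ne_zero F hx, absInfty_of_ne_zero F hy]
  rcases le_max_iff.1 (RatFunc.intDegree_add_le hy hxy) with h | h
  · exact le_max_of_le_left (zpow_le_zpow_right₀ hq h)
  · exact le_max_of_le_right (zpow_le_zpow_right₀ hq h)

/-- `K_∞`, the completion of `K = F(θ)` with respect to `|·|_∞`. -/
abbrev KInfty : Type _ := (absInfty F).Completion

instance KInfty.isUltrametricDist : IsUltrametricDist (KInfty F) :=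
  IsUltrametricDist.isUltrametricDist_of_forall_norm_add_le_max_norm fun x y => by
    induction x, y using UniformSpace.Completion.induction_on₂ with
    | hp => exact isClosed_le (by fun_prop) (by fun_prop)
    | ih a b =>
      rw [← UniformSpace.Completion.coe_add]
      simp only [UniformSpace.Completion.norm_coe, WithAbs.norm_eq_apply_ofAbs, WithAbs.ofAbs_add]
      exact absInfty_add_le_max F _ _

instance KInfty.nontriviallyNormedField : NontriviallyNormedField (KInfty F) where
  non_trivial := by
    refine ⟨((WithAbs.toAbs (absInfty F) RatFunc.X : WithAbs (absInfty F)) : KInfty F), ?_⟩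
    rw [UniformSpace.Completion.norm_coe, WithAbs.norm_toAbs_eq, absInfty_X]
    exact_mod_cast Finite.one_lt_card

/-- An algebraic closure of `K_∞`. -/
abbrev KInftyAlgCl : Type _ := AlgebraicClosure (KInfty F)

/-- The unique extension of `|·|_∞` to the algebraic closure of `K_∞`. -/
instance KInftyAlgCl.nontriviallyNormedField : NontriviallyNormedField (KInftyAlgCl F) :=
  spectralNorm.nontriviallyNormedField (KInfty F) (KInftyAlgCl F)

/-- `ℂ_∞`, the completion of the algebraic closure of `K_∞`. -/
abbrev CInfty : Type _ := UniformSpace.Completion (KInftyAlgCl F)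

/-- The embedding of `K = F(θ)` into `ℂ_∞`. -/
def embedding : RatFunc F →+* CInfty F :=
  (algebraMap (KInftyAlgCl F) (CInfty F)).comp <|
    (algebraMap (KInfty F) (KInftyAlgCl F)).comp <|
      (algebraMap (WithAbs (absInfty F)) (KInfty F)).comp
        (WithAbs.equiv (absInfty F)).symm.toRingHom

instance CInfty.algebra : Algebra (RatFunc F) (CInfty F) := (embedding F).toAlgebra

theorem norm_algebraMap (x : RatFunc F) :
    ‖algebraMap (RatFunc F) (CInfty F) x‖ = absInfty F x := by
  change ‖((algebraMap (KInfty F) (KInftyAlgCl F)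
    ((WithAbs.toAbs (absInfty F) x : WithAbs (absInfty F)) : KInfty F) : KInftyAlgCl F) :
      CInfty F)‖ = _
  rw [UniformSpace.Completion.norm_coe]
  change spectralNorm (KInfty F) (KInftyAlgCl F) _ = _
  rw [spectralNorm_extends, UniformSpace.Completion.norm_coe, WithAbs.norm_toAbs_eq]

/-- The element `θ` of `ℂ_∞`. -/
def theta : CInfty F := algebraMap (RatFunc F) (CInfty F) RatFunc.X

theorem norm_theta : ‖theta F‖ = Nat.card F := by
  rw [theta, norm_algebraMap, absInfty_X]

/-- `K̄`, the algebraic closure of `K = F(θ)` inside `ℂ_∞`. -/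
abbrev KBar : IntermediateField (RatFunc F) (CInfty F) :=
  algebraicClosure (RatFunc F) (CInfty F)

/-- The field `ℂ_∞((t))` of Laurent series over `ℂ_∞`. -/
abbrev CLaurent : Type _ := LaurentSeries (CInfty F)

/-- The variable `t`, as an element of `ℂ_∞((t))`. -/
def tVar : CLaurent F := HahnSeries.single 1 1

/-- `K̄(t)`, the subfield of `ℂ_∞((t))` generated by the constants in `K̄` and by `t`. -/
abbrev KBarT : Subfield (CLaurent F) :=
  Subfield.closure (HahnSeries.C '' (KBar F : Set (CInfty F)) ∪ {tVar F})

end Field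

section Functions

open scoped PowerSeries.WithPiTopology

variable (F : Type*) [Field F] [Finite F]

/-- The factor `1 - t / θ ^ (q ^ j)`. -/
def omegaFactor (j : ℕ) : PowerSeries (CInfty F) :=
  1 - PowerSeries.C ((theta F ^ Nat.card F ^ j)⁻¹) * PowerSeries.X

/-- The infinite product `∏_{j ≥ 1} (1 - t / θ ^ (q ^ j))` in `ℂ_∞[[t]]`, for the topology of
coefficientwise convergence (see `multipliable_omegaFactor` for its convergence). -/
def omegaProduct : PowerSeries (CInfty F) := ∏' j : ℕ, omegaFactor F (j + 1)

theorem multipliable_omegaFactor : Multipliable fun j : ℕ => omegaFactor F (j + 1) := by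
  have hq : 1 < Nat.card F := Finite.one_lt_card
  have hq' : (1 : ℝ) < Nat.card F := by exact_mod_cast hq
  set a : ℕ → CInfty F := fun j => -(theta F ^ Nat.card F ^ (j + 1))⁻¹ with ha
  have hsum : Summable fun j => ‖a j‖ := by
    refine Summable.of_nonneg_of_le (fun _ => norm_nonneg _) (fun j => ?_)
      (summable_geometric_of_lt_one (inv_nonneg.2 (by positivity)) (inv_lt_one_of_one_lt₀ hq'))
    rw [ha]
    simp only [norm_neg, norm_inv, norm_pow, norm_theta, inv_pow]
    refine inv_anti₀ (by positivity) (pow_le_pow_right₀ hq'.le ?_)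
    exact (Nat.le_succ j).trans (Nat.lt_pow_self hq).le
  have hprod := summable_finsetProd_of_summable_norm hsum
  have key : Summable fun s : Finset ℕ => ∏ i ∈ s, (PowerSeries.C (a i) * PowerSeries.X) := by
    have hco : ∀ n : ℕ, Summable fun s : Finset ℕ =>
        PowerSeries.coeff n (∏ i ∈ s, (PowerSeries.C (a i) * PowerSeries.X)) := by
      intro n
      have : (fun s : Finset ℕ =>
          PowerSeries.coeff n (∏ i ∈ s, (PowerSeries.C (a i) * PowerSeries.X)))
          = Set.indicator {s : Finset ℕ | s.card = n} fun s => ∏ i ∈ s, a i := by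
        funext s
        rw [Finset.prod_mul_distrib, Finset.prod_const, ← map_prod, PowerSeries.coeff_C_mul,
          PowerSeries.coeff_X_pow]
        by_cases h : s.card = n
        · simp [h]
        · simp [h, Ne.symm h]
      rw [this]
      exact hprod.indicator _
    refine ⟨PowerSeries.mk fun n => ∑' s : Finset ℕ,
      PowerSeries.coeff n (∏ i ∈ s, (PowerSeries.C (a i) * PowerSeries.X)), ?_⟩
    rw [HasSum, PowerSeries.WithPiTopology.tendsto_iff_coeff_tendsto]
    intro n
    simpa [HasSum, map_sum] using (hco n).hasSum
  have := multipliable_one_add_of_summable_prod key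
  refine this.congr fun j => ?_
  simp [omegaFactor, ha, sub_eq_add_neg]

variable {F}

/-- `Ω(t) = λ ^ (-q) ∏_{j ≥ 1} (1 - t / θ ^ (q ^ j))`, where `λ` is meant to be a `(q - 1)`-th root
of `-θ`. -/
def Omega (lam : CInfty F) : PowerSeries (CInfty F) :=
  PowerSeries.C ((lam ^ Nat.card F)⁻¹) * omegaProduct F

/-- The Anderson–Thakur function `ω(t) = 1 / ((t - θ) Ω(t))`, as an element of `ℂ_∞((t))`. -/
def omega (lam : CInfty F) : CLaurent F :=
  ((tVar F - HahnSeries.C (theta F)) * HahnSeries.ofPowerSeries ℤ (CInfty F) (Omega lam))⁻¹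

/-- The `n`-th hyperderivative with respect to `t`,
`∑ x_i t ^ i ↦ ∑ (i choose n) x_i t ^ (i - n)`. -/
def hyperderiv (n : ℕ) (f : CLaurent F) : CLaurent F :=
  LaurentSeries.hasseDeriv (CInfty F) n f

end Functions

end AndersonThakur

end

/-! The `q`-power Frobenius `ψ` of `ℂ_∞`, applied to coefficients, turns the product for `Ω` into
the functional equation `ω^ψ = (t - θ) ω` (`mapLaurent_omega`). Hyperderivatives commute with `ψ`,
so with `s = t - θ` the functions `x_n = ∂^(n) ω` satisfy `τ x_n = s x_n + x_{n-1}`. Independence is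
proved over the larger field `k = ℂ_∞(t)`, on which `τ` restricts to an endomorphism `φ`.

Take a monic relation `g` of least lexicographic degree, and let `D` be the total degree of its
leading monomial. Applying `τ` gives a relation with leading coefficient `s^D`; subtracting `s^D g`
must give zero by minimality. Hence `g` is a semi-invariant of the substitution `twist φ s 1`. By
`exists_eq_C_mul_of_twist` every such semi-invariant is `c x_0^D`, which contradicts `ω ≠ 0`.

To classify semi-invariants, the shifts `x_n ↦ x_n + v x_{n-1}` are used: those with `φ v = v`
commute with the twist, so by induction they change `g` by `h(v) x_0^D`, with `h` a polynomial over
the fixed field of `φ`. Taking `v = s⁻¹` gives an equation `φ a + h(s⁻¹) = a`, and counting poles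
along the orbit `θ^(q^m)`, `m ∈ ℤ`, forces `h = 0`. A homogeneous polynomial invariant under all
shifts is constant on the elementary symmetric polynomials, so it is a multiple of `x_0^D`. -/

noncomputable section

/-! ### Leading terms of the twisted substitution in the lexicographic order -/

namespace TwistedShift

open MvPolynomial OrderDual
open scoped MonomialOrder

/-- The sequence `0, x 0, x 1, …`. -/
def shiftSeq {S : Type*} [Zero S] (x : ℕ → S) : ℕ → S
  | 0 => 0
  | n + 1 => x n

theorem map_shiftSeq {S T : Type*} [Semiring S] [Semiring T] (f : S →+* T) (x : ℕ → S) (n : ℕ) :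
    f (shiftSeq x n) = shiftSeq (fun i => f (x i)) n := by
  cases n <;> simp [shiftSeq]

variable {k : Type*} [Field k]

/-- The variables `x_n`. They are indexed by `ℕᵒᵈ`, so that `x_n` is larger than all monomials in
`x_0, …, x_{n-1}` for the lexicographic order. -/
abbrev var (k : Type*) [Field k] (n : ℕ) : MvPolynomial ℕᵒᵈ k := X (toDual n)

/-- The endomorphism of `k[x_0, x_1, …]` that acts by `φ` on `k` and sends `x_n` to
`a x_n + b x_{n-1}`, where `x_{-1} = 0`. -/
def twist (φ : k →+* k) (a b : k) : MvPolynomial ℕᵒᵈ k →+* MvPolynomial ℕᵒᵈ k :=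
  eval₂Hom (C.comp φ) fun n => C a * X n + C b * shiftSeq (var k) (ofDual n)

@[simp]
theorem twist_C (φ : k →+* k) (a b c : k) : twist φ a b (C c) = C (φ c) := by
  simp [twist]

@[simp]
theorem twist_X (φ : k →+* k) (a b : k) (n : ℕᵒᵈ) :
    twist φ a b (X n) = C a * X n + C b * shiftSeq (var k) (ofDual n) := by
  simp [twist]

theorem twist_shiftSeq (φ : k →+* k) (a b : k) (n : ℕ) :
    twist φ a b (shiftSeq (var k) n) =
      C a * shiftSeq (var k) n + C b * shiftSeq (shiftSeq (var k)) n := by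
  cases n <;> simp [shiftSeq]

theorem degree_shiftSeq_lt (b : k) (n : ℕᵒᵈ) :
    MonomialOrder.lex.degree (C b * shiftSeq (var k) (ofDual n)) ≺[MonomialOrder.lex]
      Finsupp.single n 1 := by
  have h0 : (0 : ℕᵒᵈ →₀ ℕ) ≺[MonomialOrder.lex] Finsupp.single n 1 := by
    rw [map_zero, MonomialOrder.toSyn_lt_iff_ne_zero]
    simp
  induction n using OrderDual.rec with | toDual m
  cases m with
  | zero => simpa [shiftSeq] using h0
  | succ m =>
    have : C b * shiftSeq (var k) (ofDual (toDual (m + 1))) =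
        monomial (Finsupp.single (toDual m) 1) b := by
      rw [ofDual_toDual, shiftSeq, var, X, C_mul_monomial, mul_one]
    rw [this]
    refine (MonomialOrder.degree_monomial_le _).trans_lt ?_
    rw [MonomialOrder.lex_lt_iff, Finsupp.Lex.single_lt_iff]
    exact toDual_lt_toDual.2 (Nat.lt_succ_self m)

theorem degree_twist_X (φ : k →+* k) {a : k} (ha : a ≠ 0) (b : k) (n : ℕᵒᵈ) :
    MonomialOrder.lex.degree (twist φ a b (X n)) = Finsupp.single n 1 ∧
      MonomialOrder.lex.leadingCoeff (twist φ a b (X n)) = a := by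
  have h1 : C a * X n = monomial (Finsupp.single n 1) a := by
    rw [X, C_mul_monomial, mul_one]
  have h2 : MonomialOrder.lex.degree (C a * X n) = Finsupp.single n 1 := by
    classical
    rw [h1, MonomialOrder.degree_monomial, if_neg ha]
  rw [twist_X]
  have h3 := degree_shiftSeq_lt b n
  rw [← h2] at h3
  rw [MonomialOrder.degree_add_of_lt h3, MonomialOrder.leadingCoeff_add_of_lt h3, h2, h1,
    MonomialOrder.leadingCoeff_monomial]
  exact ⟨rfl, rfl⟩

/-- The substitution is triangular: the leading term of the image of `x_n` is `a x_n`, and leading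
terms multiply. -/
theorem degree_twist_monomial (φ : k →+* k) {a : k} (ha : a ≠ 0) (b : k) (m : ℕᵒᵈ →₀ ℕ) (c : k) :
    MonomialOrder.lex.degree (twist φ a b (monomial m c)) ≼[MonomialOrder.lex] m ∧
      coeff m (twist φ a b (monomial m c)) = a ^ m.degree * φ c := by
  have hX : ∀ n, twist φ a b (X n) ≠ 0 := fun n h => by
    have := (degree_twist_X φ ha b n).2
    rw [h, MonomialOrder.leadingCoeff_zero] at this
    exact ha this.symm
  have h1 : twist φ a b (monomial m c) =
      C (φ c) * ∏ n ∈ m.support, (twist φ a b (X n)) ^ m n := by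
    rw [monomial_eq, map_mul, twist_C, Finsupp.prod, map_prod]
    simp only [map_pow]
  have hsum : ∑ n ∈ m.support, MonomialOrder.lex.degree (twist φ a b (X n) ^ m n) = m := by
    conv_rhs => rw [← Finsupp.sum_single m, Finsupp.sum]
    refine Finset.sum_congr rfl fun n _ => ?_
    rw [MonomialOrder.degree_pow, (degree_twist_X φ ha b n).1]
    simp
  have h2 : MonomialOrder.lex.degree (∏ n ∈ m.support, (twist φ a b (X n)) ^ m n) = m := by
    rw [MonomialOrder.degree_prod fun n _ => pow_ne_zero _ (hX n), hsum]
  constructor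
  · rw [h1]
    refine MonomialOrder.degree_mul_le.trans ?_
    rw [h2, MonomialOrder.degree_C, zero_add]
  · rw [h1, coeff_C_mul, mul_comm]
    congr 1
    have := MonomialOrder.lex.coeff_prod_sum_degree (fun n => (twist φ a b (X n)) ^ m n) m.support
    rw [hsum] at this
    rw [this]
    simp only [MonomialOrder.leadingCoeff_pow, (degree_twist_X φ ha b _).2]
    rw [Finset.prod_pow_eq_pow_sum]
    rfl

theorem degree_twist_le (φ : k →+* k) {a : k} (ha : a ≠ 0) (b : k) (f : MvPolynomial ℕᵒᵈ k) :
    MonomialOrder.lex.degree (twist φ a b f) ≼[MonomialOrder.lex] MonomialOrder.lex.degree f := by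
  conv_lhs => rw [f.as_sum, map_sum]
  refine MonomialOrder.degree_sum_le.trans (Finset.sup_le fun m hm => ?_)
  exact (degree_twist_monomial φ ha b m _).1.trans (MonomialOrder.le_degree hm)

theorem coeff_degree_twist (φ : k →+* k) {a : k} (ha : a ≠ 0) (b : k) (f : MvPolynomial ℕᵒᵈ k) :
    coeff (MonomialOrder.lex.degree f) (twist φ a b f) =
      a ^ (MonomialOrder.lex.degree f).degree * φ (MonomialOrder.lex.leadingCoeff f) := by
  by_cases hf : f = 0
  · simp [hf]
  conv_lhs => rw [f.as_sum, map_sum, ← f.as_sum, coeff_sum]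
  rw [Finset.sum_eq_single (MonomialOrder.lex.degree f)]
  · rw [(degree_twist_monomial φ ha b _ _).2]
    rfl
  · intro m hm hne
    refine MonomialOrder.coeff_eq_zero_of_lt ((degree_twist_monomial φ ha b m _).1.trans_lt ?_)
    exact lt_of_le_of_ne (MonomialOrder.le_degree hm)
      fun h => hne (MonomialOrder.lex.toSyn.injective h)
  · intro h
    exact absurd (MonomialOrder.degree_mem_support hf) h

/-- Two polynomials of degree at most `d` with the same coefficient at `d` are equal or differ by
a polynomial of lower degree. -/
theorem sub_eq_zero_or_degree_sub_lt {ι R : Type*} [CommRing R] (o : MonomialOrder ι)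
    {f g : MvPolynomial ι R} {d : ι →₀ ℕ} (hf : o.degree f ≼[o] d) (hg : o.degree g ≼[o] d)
    (h : coeff d f = coeff d g) : f - g = 0 ∨ o.degree (f - g) ≺[o] d := by
  by_cases h0 : f - g = 0
  · exact Or.inl h0
  refine Or.inr (lt_of_le_of_ne (MonomialOrder.degree_sub_le.trans (sup_le hf hg)) fun he => ?_)
  have := MonomialOrder.degree_mem_support (m := o) h0
  rw [o.toSyn.injective he, mem_support_iff, coeff_sub, h, sub_self] at this
  exact this rfl

end TwistedShift

end

/-! ### Shift invariants, semi-invariants and the independence criterion -/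

noncomputable section

namespace TwistedShift

open MvPolynomial OrderDual
open scoped MonomialOrder

theorem eval₂Hom_mul_of_isHomogeneous {ι R S : Type*} [CommSemiring R] [CommSemiring S]
    {g : MvPolynomial ι R} {D : ℕ} (hg : g.IsHomogeneous D) (φ : R →+* S) (c : S) (x : ι → S) :
    eval₂Hom φ (fun n => c * x n) g = c ^ D * eval₂Hom φ x g := by
  rw [coe_eval₂Hom, coe_eval₂Hom, eval₂_eq, eval₂_eq, Finset.mul_sum]
  refine Finset.sum_congr rfl fun m hm => ?_
  simp only [mul_pow, Finset.prod_mul_distrib]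
  rw [Finset.prod_pow_eq_pow_sum, hg.degree_eq_sum_deg_support hm]
  ring

theorem _root_.Multiset.esymm_cons_succ {R : Type*} [CommSemiring R] (a : R) (s : Multiset R)
    (n : ℕ) : (a ::ₘ s).esymm (n + 1) = s.esymm (n + 1) + a * s.esymm n := by
  rw [Multiset.esymm, Multiset.powersetCard_cons, Multiset.map_add, Multiset.sum_add,
    Multiset.map_map, Multiset.esymm, Multiset.esymm, ← Multiset.sum_map_mul_left]
  simp

variable {k : Type*} [Field k]

/-- Evaluation at `x_0 = 1` and `x_n = 0` for `n ≥ 1`. -/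
def evalOne (k : Type*) [Field k] : MvPolynomial ℕᵒᵈ k →+* k :=
  eval fun n => if ofDual n = 0 then 1 else 0

theorem eval_twist (v : k) (y : ℕ → k) (g : MvPolynomial ℕᵒᵈ k) :
    eval (fun n => y (ofDual n)) (twist (RingHom.id k) 1 v g) =
      eval (fun n => y (ofDual n) + v * shiftSeq y (ofDual n)) g := by
  rw [← RingHom.comp_apply]
  congr 1
  ext n
  · simp
  · simp [map_shiftSeq]

/-- Adding an element `a` to a multiset replaces `e_n` by `e_n + a e_{n-1}`, which is the shift by
`v = a`. An invariant therefore keeps the value it has on the empty multiset, where `e_0 = 1` and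
all other `e_n` vanish. -/
theorem eval_esymm {g : MvPolynomial ℕᵒᵈ k} (hg : ∀ v, twist (RingHom.id k) 1 v g = g)
    (s : Multiset k) : eval (fun n => s.esymm (ofDual n)) g = evalOne k g := by
  induction s using Multiset.induction with
  | empty =>
    rw [evalOne]
    congr 2
    funext n
    rcases h : ofDual n with _ | m <;> simp [Multiset.esymm, Multiset.powersetCard_zero_right]
  | cons a s ih =>
    rw [← ih]
    conv_rhs => rw [← hg a, eval_twist]
    congr 2
    funext n
    rcases h : ofDual n with _ | m
    · simp [Multiset.esymm, shiftSeq]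
    · rw [Multiset.esymm_cons_succ, shiftSeq]

/-- The homogeneous polynomials that are invariant under `x_n ↦ x_n + v x_{n-1}` for all `v` are
the multiples of powers of `x_0`. -/
theorem eq_C_mul_of_twist_eq [Infinite k] {g : MvPolynomial ℕᵒᵈ k} {D : ℕ}
    (hD : g.IsHomogeneous D) (hg : ∀ v, twist (RingHom.id k) 1 v g = g) :
    g = C (evalOne k g) * var k 0 ^ D := by
  classical
  set N := (g.vars.image ofDual).sup id
  have hvars : ∀ n ∈ g.vars, ofDual n ≤ N := fun n hn =>
    Finset.le_sup (f := id) (Finset.mem_image_of_mem ofDual hn)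
  -- Dehomogenization at `x_0 = 1`: `x_n` becomes the variable of index `n - 1`, which is later sent
  -- to `e_n`. The value `0` beyond `N` matches `e_n = 0` in `N` variables.
  let y : ℕᵒᵈ → MvPolynomial (Fin N) k := fun n =>
    if ofDual n = 0 then 1 else if h : ofDual n - 1 < N then X ⟨ofDual n - 1, h⟩ else 0
  have hy : aeval y g = C (evalOne k g) := by
    -- Elementary symmetric polynomials are algebraically independent, so constancy may be tested
    -- after substituting them.
    apply esymmAlgHom_injective (σ := Fin N) k (by simp)
    apply Subtype.ext
    rw [esymmAlgHom_apply, esymmAlgHom_apply]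
    refine MvPolynomial.funext fun v => ?_
    have h2 : eval v (aeval (fun i : Fin N => esymm (Fin N) k (i + 1)) (C (evalOne k g))) =
        evalOne k g := by simp
    rw [h2, ← eval_esymm hg (Finset.univ.val.map v)]
    change ((eval v).comp ((aeval fun i : Fin N => esymm (Fin N) k (i + 1)).toRingHom.comp
      (aeval y).toRingHom)) g = _
    congr 1
    ext n
    · simp
    · simp only [RingHom.comp_apply, AlgHom.toRingHom_eq_coe, RingHom.coe_coe, aeval_X, eval_X]
      simp only [y]
      have hes : ∀ j, eval v (esymm (Fin N) k j) = (Finset.univ.val.map v).esymm j := fun j => by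
        rw [← aeval_esymm_eq_multiset_esymm (Fin N) k, aeval_eq_eval]
      split_ifs with h0 h1
      · simp [h0, Multiset.esymm]
      · rw [aeval_X, hes]
        simp only
        rw [Nat.sub_add_cancel (Nat.pos_of_ne_zero h0)]
      · rw [map_zero, map_zero, Multiset.esymm, Multiset.powersetCard_eq_empty]
        · simp
        · simp
          omega
  -- The factor `x_0` takes care of the points with `z_0 = 0`; at the others, homogeneity allows
  -- scaling to `z_0 = 1`.
  have h0 : var k 0 * (g - C (evalOne k g) * var k 0 ^ D) = 0 := by
    refine MvPolynomial.funext fun z => ?_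
    by_cases hz : z (toDual 0) = 0
    · rw [map_mul, eval_X, hz, zero_mul, map_zero]
    suffices h : eval z g = z (toDual 0) ^ D * evalOne k g by
      simp [h]
      exact Or.inr (by ring)
    have h1 : eval (fun n => (z (toDual 0))⁻¹ * z n) g = evalOne k g := by
      have := congrArg (eval fun i : Fin N => (z (toDual 0))⁻¹ * z (toDual (i + 1))) hy
      rw [eval_C] at this
      rw [← this]
      change _ = ((eval fun i : Fin N => (z (toDual 0))⁻¹ * z (toDual (i + 1))).comp
        (aeval y).toRingHom) g
      refine hom_congr_vars (by ext; simp) (fun n hn _ => ?_) rfl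
      simp only [RingHom.comp_apply, AlgHom.toRingHom_eq_coe, RingHom.coe_coe, aeval_X, eval_X]
      simp only [y]
      have hnN := hvars n hn
      split_ifs with h0 h1
      · rw [map_one, ← inv_mul_cancel₀ hz, ← h0, toDual_ofDual]
      · rw [eval_X]
        simp only
        rw [Nat.sub_add_cancel (Nat.pos_of_ne_zero h0), toDual_ofDual]
      · omega
    rw [← h1]
    have := eval₂Hom_mul_of_isHomogeneous hD (RingHom.id k) (z (toDual 0))
      (fun n => (z (toDual 0))⁻¹ * z n)
    simp only [mul_inv_cancel_left₀ hz] at this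
    exact this
  exact sub_eq_zero.1 ((mul_eq_zero.1 h0).resolve_left (X_ne_zero _))

/-- The universal version of `x_n ↦ x_n + z x_{n-1}`. -/
def genericTwist (k : Type*) [Field k] :
    MvPolynomial ℕᵒᵈ k →+* Polynomial (MvPolynomial ℕᵒᵈ k) :=
  eval₂Hom (Polynomial.C.comp C) fun n =>
    Polynomial.C (X n) + Polynomial.X * Polynomial.C (shiftSeq (var k) (ofDual n))

theorem eval_genericTwist (v : k) (g : MvPolynomial ℕᵒᵈ k) :
    (genericTwist k g).eval (C v) = twist (RingHom.id k) 1 v g := by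
  have : (Polynomial.evalRingHom (C v)).comp (genericTwist k) = twist (RingHom.id k) 1 v := by
    refine ringHom_ext (fun r => ?_) fun n => ?_
    · simp [genericTwist]
    · simp [genericTwist]
      ring
  exact RingHom.congr_fun this g

theorem twist_comm (φ : k →+* k) (s v : k) (hv : φ v = v) (g : MvPolynomial ℕᵒᵈ k) :
    twist φ s 1 (twist (RingHom.id k) 1 v g) = twist (RingHom.id k) 1 v (twist φ s 1 g) := by
  have : (twist φ s 1).comp (twist (RingHom.id k) 1 v) =
      (twist (RingHom.id k) 1 v).comp (twist φ s 1) := by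
    refine ringHom_ext (fun r => ?_) fun n => ?_
    · simp
    · simp only [RingHom.comp_apply, twist_X, map_add, map_mul, twist_C, twist_shiftSeq, hv,
        RingHom.id_apply, map_one]
      ring
  exact RingHom.congr_fun this g

theorem map_twist (φ : k →+* k) (v : k) (g : MvPolynomial ℕᵒᵈ k) :
    map φ (twist (RingHom.id k) 1 v g) = twist (RingHom.id k) 1 (φ v) (map φ g) := by
  have : (map φ).comp (twist (RingHom.id k) 1 v) =
      (twist (RingHom.id k) 1 (φ v)).comp (map φ) := by
    refine ringHom_ext (fun r => ?_) fun n => ?_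
    · simp
    · simp [map_shiftSeq]
  exact RingHom.congr_fun this g

/-- From `s x_n + x_{n-1} = s (x_n + s⁻¹ x_{n-1})`: semi-invariance becomes a statement about the
shift by `s⁻¹`. -/
theorem twist_eq_of_isHomogeneous (φ : k →+* k) {s : k} (hs : s ≠ 0) {g : MvPolynomial ℕᵒᵈ k}
    {D : ℕ} (hg : g.IsHomogeneous D) :
    twist φ s 1 g = C (s ^ D) * twist (RingHom.id k) 1 s⁻¹ (map φ g) := by
  have h1 : twist (RingHom.id k) 1 s⁻¹ (map φ g) =
      eval₂Hom (C.comp φ) (fun n => X n + C s⁻¹ * shiftSeq (var k) (ofDual n)) g := by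
    have : (twist (RingHom.id k) 1 s⁻¹).comp (map φ) =
        eval₂Hom (C.comp φ) (fun n => X n + C s⁻¹ * shiftSeq (var k) (ofDual n)) := by
      refine ringHom_ext (fun r => ?_) fun n => ?_ <;> simp
    exact RingHom.congr_fun this g
  rw [h1, map_pow, ← eval₂Hom_mul_of_isHomogeneous hg, twist]
  congr 2
  funext n
  rw [mul_add, ← mul_assoc, ← C_mul, mul_inv_cancel₀ hs]

theorem isHomogeneous_twist (φ : k →+* k) (a b : k) {g : MvPolynomial ℕᵒᵈ k} {D : ℕ}
    (hg : g.IsHomogeneous D) : (twist φ a b g).IsHomogeneous D := by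
  have := hg.eval₂ (C.comp φ) (fun n => C a * X n + C b * shiftSeq (var k) (ofDual n)) (n := 1)
    (fun r => isHomogeneous_C _ _) fun n => by
      refine ((isHomogeneous_X k n).C_mul a).add (IsHomogeneous.C_mul ?_ b)
      cases ofDual n with
      | zero => exact isHomogeneous_zero _ _ _
      | succ m => exact isHomogeneous_X _ _
  rwa [one_mul] at this

theorem homogeneousComponent_twist (φ : k →+* k) (a b : k) (g : MvPolynomial ℕᵒᵈ k) (d : ℕ) :
    homogeneousComponent d (twist φ a b g) = twist φ a b (homogeneousComponent d g) := by
  conv_lhs => rw [← sum_homogeneousComponent g, map_sum, map_sum]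
  rw [Finset.sum_congr rfl fun i _ => homogeneousComponent_of_mem
    (isHomogeneous_twist φ a b (homogeneousComponent_isHomogeneous i g))]
  rw [Finset.sum_ite_eq]
  split_ifs with h
  · rfl
  · rw [homogeneousComponent_eq_zero, map_zero]
    simpa using h

@[simp]
theorem evalOne_C (c : k) : evalOne k (C c) = c := by simp [evalOne]

@[simp]
theorem evalOne_var_zero : evalOne k (var k 0) = 1 := by
  rw [evalOne, var, eval_X, ofDual_toDual, if_pos rfl]

theorem evalOne_map (φ : k →+* k) (g : MvPolynomial ℕᵒᵈ k) :
    evalOne k (map φ g) = φ (evalOne k g) := by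
  have : (evalOne k).comp (map φ) = φ.comp (evalOne k) := by
    refine ringHom_ext (fun r => ?_) fun n => ?_
    · simp
    · simp [evalOne, apply_ite φ]
  exact RingHom.congr_fun this g

/-- If the increments of `g` under `x_n ↦ x_n + v x_{n-1}` are multiples of `x_0 ^ D` for
infinitely many `v`, then for all `v` they are given by the same polynomial in `v`. -/
theorem twist_eq_add_of_infinite {g : MvPolynomial ℕᵒᵈ k} {D : ℕ} {s : Set k} (hs : s.Infinite)
    {h : Polynomial k}
    (hg : ∀ v ∈ s, twist (RingHom.id k) 1 v g = g + C (h.eval v) * var k 0 ^ D) (v : k) :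
    twist (RingHom.id k) 1 v g = g + C (h.eval v) * var k 0 ^ D := by
  have hC : ∀ v : k, (h.map C).eval (C v : MvPolynomial ℕᵒᵈ k) = C (h.eval v) := fun v => by
    rw [Polynomial.eval_map, Polynomial.eval₂_at_apply]
  have key : genericTwist k g = Polynomial.C g + h.map C * Polynomial.C (var k 0 ^ D) := by
    refine Polynomial.eq_of_infinite_eval_eq _ _
      ((hs.image (C_injective ℕᵒᵈ k).injOn).mono ?_)
    rintro _ ⟨v, hv, rfl⟩
    simp only [Set.mem_ofPred_eq, eval_genericTwist, hg v hv, Polynomial.eval_add,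
      Polynomial.eval_mul, Polynomial.eval_C, hC]
  rw [← eval_genericTwist, key]
  simp only [Polynomial.eval_add, Polynomial.eval_mul, Polynomial.eval_C, hC]

theorem exists_eq_C_mul_of_isHomogeneous (φ : k →+* k) {s : k} (hs : s ≠ 0)
    (hinf : {c : k | φ c = c}.Infinite)
    (hadd : ∀ (a : k) (h : Polynomial k), h.map φ = h → φ a + h.eval s⁻¹ = a → h.natDegree = 0)
    {D : ℕ} (g : MvPolynomial ℕᵒᵈ k) (hD : g.IsHomogeneous D)
    (hg : twist φ s 1 g = C (s ^ D) * g) : ∃ c, g = C c * var k 0 ^ D := by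
  induction hd : MonomialOrder.lex.toSyn (MonomialOrder.lex.degree g) using
    WellFoundedLT.induction generalizing g with
  | ind d ih =>
  subst hd
  -- The shift by a fixed `v` commutes with the twist and preserves the leading term, so the
  -- increment of `g` is a semi-invariant of lower degree, to which the induction hypothesis
  -- applies.
  have hstep : ∀ v, φ v = v → ∃ c, φ c = c ∧
      twist (RingHom.id k) 1 v g = g + C c * var k 0 ^ D := by
    intro v hv
    have hsemi : twist φ s 1 (twist (RingHom.id k) 1 v g - g) =
        C (s ^ D) * (twist (RingHom.id k) 1 v g - g) := by
      rw [map_sub, twist_comm _ _ _ hv, hg, map_mul, twist_C, RingHom.id_apply, mul_sub]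
    obtain ⟨c, hc⟩ : ∃ c, twist (RingHom.id k) 1 v g - g = C c * var k 0 ^ D := by
      rcases sub_eq_zero_or_degree_sub_lt MonomialOrder.lex
        (degree_twist_le (RingHom.id k) one_ne_zero v g) le_rfl
        (by rw [coeff_degree_twist _ one_ne_zero, one_pow, one_mul]; rfl) with h | h
      · exact ⟨0, by rw [h, C_0, zero_mul]⟩
      · exact ih _ h _ ((isHomogeneous_twist _ _ _ hD).sub hD) hsemi rfl
    refine ⟨c, ?_, by rw [← hc, add_sub_cancel]⟩
    rw [hc] at hsemi
    have := congrArg (evalOne k) hsemi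
    have h0 : twist φ s 1 (var k 0) = C s * var k 0 := by simp [shiftSeq]
    simp only [map_mul, map_pow, twist_C, h0, evalOne_C, evalOne_var_zero, one_pow,
      mul_one] at this
    exact mul_right_cancel₀ (pow_ne_zero D hs) (this.trans (mul_comm _ _))
  -- The coefficient of `x_0 ^ D` in the increment of `g`, as a polynomial in the shift parameter.
  set h : Polynomial k := (genericTwist k g - Polynomial.C g).map (evalOne k) with hh
  have heval : ∀ v, h.eval v = evalOne k (twist (RingHom.id k) 1 v g - g) := by
    intro v
    rw [hh, ← eval_genericTwist, ← evalOne_C v, Polynomial.eval_map, Polynomial.eval₂_at_apply]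
    simp
  have hconst : ∀ v, φ v = v → φ (h.eval v) = h.eval v ∧
      twist (RingHom.id k) 1 v g = g + C (h.eval v) * var k 0 ^ D := by
    intro v hv
    obtain ⟨c, hc, h1⟩ := hstep v hv
    have : h.eval v = c := by rw [heval, h1]; simp
    rw [this]
    exact ⟨hc, h1⟩
  have hmap : h.map φ = h := by
    refine Polynomial.eq_of_infinite_eval_eq _ _ (hinf.mono fun v hv => ?_)
    have hv' : φ v = v := hv
    have := Polynomial.eval₂_at_apply (p := h) φ v
    rw [hv', (hconst v hv).1, ← Polynomial.eval_map] at this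
    exact this
  have hall := twist_eq_add_of_infinite hinf fun v hv => (hconst v hv).2
  have hall' := twist_eq_add_of_infinite (g := map φ g) (h := h) (D := D) hinf fun v hv => by
    have hv' : φ v = v := hv
    have := map_twist φ v g
    rw [(hconst v hv).2, hv'] at this
    rw [← this, map_add, map_mul, map_C, (hconst v hv).1, map_pow, map_X]
  -- The shift by `s⁻¹` of `map φ g` has the same increment polynomial `h`, so comparing
  -- coefficients of `x_0 ^ D` gives the equation in `hadd`.
  have hdeg : h.natDegree = 0 := by
    refine hadd (evalOne k g) h hmap ?_
    rw [twist_eq_of_isHomogeneous φ hs hD, hall'] at hg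
    have h1 := mul_left_cancel₀ (C_ne_zero.2 (pow_ne_zero D hs)) hg
    have h2 := congrArg (evalOne k) h1
    simp only [map_add, map_mul, map_pow, evalOne_C, evalOne_var_zero, one_pow, mul_one] at h2
    rwa [evalOne_map] at h2
  -- A constant `h` is zero, since the shift by `0` is the identity.
  have hzero : ∀ v, h.eval v = 0 := by
    intro v
    rw [Polynomial.eq_C_of_natDegree_eq_zero hdeg, Polynomial.eval_C,
      Polynomial.coeff_zero_eq_eval_zero, heval]
    have : twist (RingHom.id k) 1 0 = RingHom.id (MvPolynomial ℕᵒᵈ k) := by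
      refine ringHom_ext (fun r => ?_) fun n => ?_ <;> simp
    rw [this]
    simp
  have : Infinite k := Set.infinite_univ_iff.1 (hinf.mono (Set.subset_univ _))
  refine ⟨_, eq_C_mul_of_twist_eq hD fun v => ?_⟩
  rw [hall v, hzero, C_0, zero_mul, add_zero]

theorem exists_eq_C_mul_of_twist (φ : k →+* k) {s : k} (hs : s ≠ 0)
    (hinf : {c : k | φ c = c}.Infinite)
    (hadd : ∀ (a : k) (h : Polynomial k), h.map φ = h → φ a + h.eval s⁻¹ = a → h.natDegree = 0)
    (hmul : ∀ (c : k) (i j : ℕ), c ≠ 0 → s ^ i * φ c = s ^ j * c → i = j)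
    {D : ℕ} {g : MvPolynomial ℕᵒᵈ k} (hg : twist φ s 1 g = C (s ^ D) * g) :
    ∃ c, g = C c * var k 0 ^ D := by
  refine exists_eq_C_mul_of_isHomogeneous φ hs hinf hadd g ?_ hg
  -- The leading coefficient `c` of a nonzero component of degree `d` would satisfy `s^d φ(c) = s^D
  -- c`.
  have hcomp : ∀ d, d ≠ D → homogeneousComponent d g = 0 := by
    intro d hd
    by_contra hne
    have h1 : twist φ s 1 (homogeneousComponent d g) = C (s ^ D) * homogeneousComponent d g := by
      rw [← homogeneousComponent_twist, hg, homogeneousComponent_C_mul]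
    have h2 := coeff_degree_twist φ hs 1 (homogeneousComponent d g)
    rw [h1, coeff_C_mul] at h2
    have h3 : (MonomialOrder.lex.degree (homogeneousComponent d g)).degree = d :=
      ((homogeneousComponent_isHomogeneous d g).degree_eq_sum_deg_support
        (MonomialOrder.degree_mem_support hne)).symm
    rw [h3] at h2
    exact hd (hmul _ _ _ (MonomialOrder.leadingCoeff_ne_zero_iff.2 hne) h2.symm)
  have : g = homogeneousComponent D g := by
    ext m
    rw [coeff_homogeneousComponent]
    split_ifs with h
    · rfl
    · have := congrArg (coeff m) (hcomp m.degree h)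
      rwa [coeff_homogeneousComponent, if_pos rfl, coeff_zero] at this
  rw [this]
  exact homogeneousComponent_isHomogeneous D g

/-- Criterion for algebraic independence of a sequence with `τ x_n = s x_n + x_{n-1}`. -/
theorem algebraicIndependent_of_twist {M : Type*} [Field M] [Algebra k M] (φ : k →+* k)
    (τ : M →+* M) (hτ : ∀ c, τ (algebraMap k M c) = algebraMap k M (φ c)) {s : k} (hs : s ≠ 0)
    (hinf : {c : k | φ c = c}.Infinite)
    (hadd : ∀ (a : k) (h : Polynomial k), h.map φ = h → φ a + h.eval s⁻¹ = a → h.natDegree = 0)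
    (hmul : ∀ (c : k) (i j : ℕ), c ≠ 0 → s ^ i * φ c = s ^ j * c → i = j)
    (x : ℕ → M) (hx0 : x 0 ≠ 0)
    (hx : ∀ n, τ (x n) = algebraMap k M s * x n + shiftSeq x n) :
    AlgebraicIndependent k x := by
  suffices h : AlgebraicIndependent k fun n : ℕᵒᵈ => x (ofDual n) from
    h.comp toDual toDual.injective
  rw [algebraicIndependent_iff]
  by_contra! hcon
  have hτx : ∀ g, aeval (fun n : ℕᵒᵈ => x (ofDual n)) (twist φ s 1 g) =
      τ (aeval (fun n : ℕᵒᵈ => x (ofDual n)) g) := by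
    intro g
    have : (aeval fun n : ℕᵒᵈ => x (ofDual n)).toRingHom.comp (twist φ s 1) =
        τ.comp (aeval fun n : ℕᵒᵈ => x (ofDual n)).toRingHom := by
      refine ringHom_ext (fun r => ?_) fun n => ?_
      · simp [hτ]
      · have := map_shiftSeq (aeval fun n : ℕᵒᵈ => x (ofDual n)).toRingHom (var k) (ofDual n)
        simp at this
        simp [hx, this]
    exact RingHom.congr_fun this g
  let S : Set (MvPolynomial ℕᵒᵈ k) := {g | aeval (fun n : ℕᵒᵈ => x (ofDual n)) g = 0 ∧ g ≠ 0}
  let deg : MvPolynomial ℕᵒᵈ k → (MonomialOrder.lex (σ := ℕᵒᵈ)).syn :=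
    fun g => MonomialOrder.lex.toSyn (MonomialOrder.lex.degree g)
  obtain ⟨g, ⟨hg0, hgne⟩, hmin⟩ := WellFounded.has_min (InvImage.wf deg wellFounded_lt) S hcon
  -- Normalization makes `φ` fix the leading coefficient, so that the leading terms of `twist φ s 1
  -- g` and `s ^ D * g` cancel.
  wlog hmonic : MonomialOrder.lex.leadingCoeff g = 1 generalizing g
  · have hlc := (MonomialOrder.leadingCoeff_ne_zero_iff (m := MonomialOrder.lex)).2 hgne
    have hu := inv_ne_zero hlc
    have hdeg : MonomialOrder.lex.degree (C (MonomialOrder.lex.leadingCoeff g)⁻¹ * g) =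
        MonomialOrder.lex.degree g := by
      rw [MonomialOrder.degree_mul (C_ne_zero.2 hu) hgne, MonomialOrder.degree_C, zero_add]
    refine this (C (MonomialOrder.lex.leadingCoeff g)⁻¹ * g) (fun y hy => ?_)
      (by rw [map_mul, hg0, mul_zero]) (mul_ne_zero (C_ne_zero.2 hu) hgne) ?_
    · have := hmin y hy
      simpa only [InvImage, deg, hdeg] using this
    · rw [MonomialOrder.leadingCoeff_mul, MonomialOrder.leadingCoeff_C, inv_mul_cancel₀ hlc]
  set D := (MonomialOrder.lex.degree g).degree with hDdef
  have hsemi : twist φ s 1 g = C (s ^ D) * g := by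
    rw [← sub_eq_zero]
    have hle : MonomialOrder.lex.degree (C (s ^ D) * g) ≼[MonomialOrder.lex]
        MonomialOrder.lex.degree g := by
      refine MonomialOrder.degree_mul_le.trans ?_
      rw [MonomialOrder.degree_C, zero_add]
    rcases sub_eq_zero_or_degree_sub_lt MonomialOrder.lex (degree_twist_le φ hs 1 g) hle
      (by rw [coeff_degree_twist _ hs, hmonic, coeff_C_mul, map_one]
          change _ = s ^ D * MonomialOrder.lex.leadingCoeff g
          rw [hmonic]) with h | h
    · exact h
    · by_contra hne
      refine hmin _ ⟨?_, hne⟩ h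
      rw [map_sub, hτx, hg0, map_mul, hg0, mul_zero, map_zero, sub_zero]
  obtain ⟨c, hgc⟩ := exists_eq_C_mul_of_twist φ hs hinf hadd hmul hsemi
  have hc : c ≠ 0 := by
    rintro rfl
    exact hgne (by rw [hgc, C_0, zero_mul])
  rw [hgc, map_mul, map_pow, aeval_C, aeval_X, ofDual_toDual] at hg0
  exact mul_ne_zero ((map_ne_zero _).2 hc) (pow_ne_zero _ hx0) hg0

end TwistedShift

end

/-! ### Poles of rational functions along an infinite orbit -/

noncomputable section

namespace TwistedShift

open Polynomial

variable {K : Type*} [Field K]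

/-- The ring of rational functions without pole at `α`. -/
def regularAt (α : K) : Subring (RatFunc K) where
  carrier := {r | ∃ p q : K[X], q.eval α ≠ 0 ∧ r * algebraMap K[X] (RatFunc K) q =
    algebraMap K[X] (RatFunc K) p}
  mul_mem' := by
    rintro a b ⟨p, q, hq, h⟩ ⟨p', q', hq', h'⟩
    refine ⟨p * p', q * q', by simp [hq, hq'], ?_⟩
    rw [map_mul, map_mul, ← h, ← h']
    ring
  one_mem' := ⟨1, 1, by simp, by simp⟩
  add_mem' := by
    rintro a b ⟨p, q, hq, h⟩ ⟨p', q', hq', h'⟩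
    refine ⟨p * q' + p' * q, q * q', by simp [hq, hq'], ?_⟩
    rw [map_mul, map_add, map_mul, map_mul, ← h, ← h']
    ring
  zero_mem' := ⟨0, 1, by simp, by simp⟩
  neg_mem' := by
    rintro a ⟨p, q, hq, h⟩
    exact ⟨-p, q, hq, by rw [map_neg, ← h, neg_mul]⟩

theorem algebraMap_mem_regularAt (α : K) (p : K[X]) :
    algebraMap K[X] (RatFunc K) p ∈ regularAt α :=
  ⟨p, 1, by simp, by simp⟩

theorem mul_algebraMap_denom (r : RatFunc K) :
    r * algebraMap K[X] (RatFunc K) r.denom = algebraMap K[X] (RatFunc K) r.num :=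
  ((div_eq_iff (RatFunc.algebraMap_ne_zero r.denom_ne_zero)).1 r.num_div_denom).symm

theorem mem_regularAt_of_denom {α : K} {r : RatFunc K} (h : r.denom.eval α ≠ 0) :
    r ∈ regularAt α := by
  exact ⟨r.num, r.denom, h, mul_algebraMap_denom r⟩

theorem denom_eval_ne_zero_of_mem {α : K} {r : RatFunc K} (h : r ∈ regularAt α) :
    r.denom.eval α ≠ 0 := by
  obtain ⟨p, q, hq, h⟩ := h
  have hq0 : q ≠ 0 := by
    rintro rfl
    simp at hq
  have : r = algebraMap K[X] (RatFunc K) p / algebraMap K[X] (RatFunc K) q :=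
    eq_div_of_mul_eq (RatFunc.algebraMap_ne_zero hq0) h
  have hdvd : r.denom ∣ q := by
    rw [this]
    exact RatFunc.denom_div_dvd p q
  intro h0
  exact hq (eval_eq_zero_of_dvd_of_eval_eq_zero hdvd h0)

theorem mem_regularAt_iff {α : K} {r : RatFunc K} : r ∈ regularAt α ↔ r.denom.eval α ≠ 0 :=
  ⟨denom_eval_ne_zero_of_mem, mem_regularAt_of_denom⟩

theorem inv_algebraMap_mem_regularAt {α : K} {p : K[X]} (h : p.eval α ≠ 0) :
    (algebraMap K[X] (RatFunc K) p)⁻¹ ∈ regularAt α := by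
  refine ⟨1, p, h, ?_⟩
  rw [map_one, inv_mul_cancel₀]
  refine RatFunc.algebraMap_ne_zero ?_
  rintro rfl
  simp at h

theorem inv_X_sub_C_notMem_regularAt (α : K) :
    (algebraMap K[X] (RatFunc K) (X - C α))⁻¹ ∉ regularAt α := by
  rintro ⟨p, q, hq, h⟩
  have h1 : q = (X - C α) * p := by
    apply RatFunc.algebraMap_injective K
    rw [map_mul, ← h, mul_inv_cancel_left₀]
    exact RatFunc.algebraMap_ne_zero (X_sub_C_ne_zero α)
  simp [h1] at hq

/-- The endomorphism of `K(X)` acting by `ψ` on coefficients. -/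
def mapCoeff (ψ : K →+* K) : RatFunc K →+* RatFunc K :=
  RatFunc.mapRingHom (Polynomial.mapRingHom ψ) (nonZeroDivisors_le_comap_nonZeroDivisors_of_injective _
    (Polynomial.map_injective ψ ψ.injective))

@[simp]
theorem mapCoeff_algebraMap (ψ : K →+* K) (p : K[X]) :
    mapCoeff ψ (algebraMap K[X] (RatFunc K) p) = algebraMap K[X] (RatFunc K) (p.map ψ) := by
  have := RatFunc.map_apply_div (R := K) (Polynomial.mapRingHom ψ)
    (nonZeroDivisors_le_comap_nonZeroDivisors_of_injective _
    (Polynomial.map_injective ψ ψ.injective)) p 1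
  simpa [mapCoeff, RatFunc.coe_mapRingHom_eq_coe_map] using this

theorem mapCoeff_mem_regularAt_iff (ψ : K →+* K) {α : K} {r : RatFunc K} :
    mapCoeff ψ r ∈ regularAt (ψ α) ↔ r ∈ regularAt α := by
  constructor
  · rintro ⟨p, q, hq, h⟩
    rw [mem_regularAt_iff]
    intro h0
    have h1 : mapCoeff ψ r * algebraMap K[X] (RatFunc K) (r.denom.map ψ) =
        algebraMap K[X] (RatFunc K) (r.num.map ψ) := by
      rw [← mapCoeff_algebraMap, ← mapCoeff_algebraMap, ← map_mul]
      rw [mul_algebraMap_denom]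
    have h2 : r.num.map ψ * q = p * r.denom.map ψ := by
      apply RatFunc.algebraMap_injective K
      rw [map_mul, map_mul, ← h, ← h1]
      ring
    -- No inverse of `ψ` is needed: a zero of the denominator at `α` would force one of the
    -- numerator, against coprimality.
    have h3 := congrArg (eval (ψ α)) h2
    rw [eval_mul, eval_mul, eval_map_apply, eval_map_apply, h0, map_zero, mul_zero] at h3
    have h4 : r.num.eval α = 0 :=
      (map_eq_zero ψ).1 ((mul_eq_zero.1 h3).resolve_right hq)
    obtain ⟨a, b, hab⟩ := r.isCoprime_num_denom
    have := congrArg (eval α) hab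
    simp [h0, h4] at this
  · rintro ⟨p, q, hq, h⟩
    refine ⟨p.map ψ, q.map ψ, ?_, ?_⟩
    · rw [eval_map_apply]
      simpa using hq
    · rw [← mapCoeff_algebraMap, ← mapCoeff_algebraMap, ← h, map_mul]

variable {ψ : K →+* K} {P : ℤ → K}

/-- A rational function has no poles on an infinite orbit of `ψ` if `ψ` moves its poles on this
orbit to poles, except possibly at one point. -/
theorem mem_regularAt_of_orbit (hP : Function.Injective P) {a : RatFunc K}
    (ha : ∀ m : ℤ, m ≠ 0 → (a ∈ regularAt (P (m - 1)) ↔ a ∈ regularAt (P m))) (m : ℤ) :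
    a ∈ regularAt (P m) := by
  classical
  have hfin : {m : ℤ | a ∉ regularAt (P m)}.Finite := by
    have : {m : ℤ | a ∉ regularAt (P m)} ⊆ P ⁻¹' (a.denom.roots.toFinset : Set K) := by
      intro m hm
      rw [Set.mem_ofPred_eq, mem_regularAt_iff, not_not] at hm
      simpa [a.denom_ne_zero] using hm
    exact (Set.Finite.preimage hP.injOn (Finset.finite_toSet _)).subset this
  -- The excluded index `0` separates the half-orbits `m ≥ 0` and `m ≤ -1`. Regularity is constant
  -- on each, and a pole would spread to infinitely many points.
  have hpos : ∀ n : ℕ, a ∈ regularAt (P n) ↔ a ∈ regularAt (P 0) := by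
    intro n
    induction n with
    | zero => simp
    | succ n ih =>
      rw [← ih, ← ha _ (by omega)]
      simp
  have hneg : ∀ n : ℕ, a ∈ regularAt (P (-1 - n)) ↔ a ∈ regularAt (P (-1)) := by
    intro n
    induction n with
    | zero => simp
    | succ n ih =>
      rw [← ih, ← ha (-1 - n) (by omega)]
      congr! 3
      push_cast
      ring
  by_contra hm
  rcases le_or_gt 0 m with h | h
  · obtain ⟨n, rfl⟩ := Int.eq_ofNat_of_zero_le h
    rw [hpos] at hm
    refine Set.infinite_of_injective_forall_mem (f := fun n : ℕ => (n : ℤ))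
      (fun _ _ h => by simpa using h) (fun n => ?_) hfin
    exact (not_congr (hpos n)).2 hm
  · obtain ⟨n, hn⟩ := Int.eq_ofNat_of_zero_le (show 0 ≤ -1 - m by omega)
    have : m = -1 - n := by omega
    rw [this, hneg] at hm
    refine Set.infinite_of_injective_forall_mem (f := fun n : ℕ => -1 - (n : ℤ))
      (fun _ _ h => by simpa using h) (fun n => ?_) hfin
    exact (not_congr (hneg n)).2 hm

theorem mem_regularAt_succ_iff (hψ : ∀ m, ψ (P m) = P (m + 1)) {a : RatFunc K} (m : ℤ) :
    mapCoeff ψ a ∈ regularAt (P m) ↔ a ∈ regularAt (P (m - 1)) := by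
  rw [← mapCoeff_mem_regularAt_iff ψ (r := a), hψ, sub_add_cancel]

theorem mem_regularAt_of_mapCoeff_eq (hP : Function.Injective P) (hψ : ∀ m, ψ (P m) = P (m + 1))
    {c : RatFunc K} (hc : mapCoeff ψ c = c) (m : ℤ) : c ∈ regularAt (P m) :=
  mem_regularAt_of_orbit hP (fun m _ => by rw [← mem_regularAt_succ_iff hψ, hc]) m

theorem X_sub_C_mem_regularAt (α β : K) :
    algebraMap K[X] (RatFunc K) (X - C α) ∈ regularAt β :=
  algebraMap_mem_regularAt _ _

theorem inv_X_sub_C_mem_regularAt (hP : Function.Injective P) {m : ℤ} (hm : m ≠ 0) :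
    (algebraMap K[X] (RatFunc K) (X - C (P 0)))⁻¹ ∈ regularAt (P m) := by
  refine inv_algebraMap_mem_regularAt ?_
  simpa [sub_eq_zero] using fun h => hm (hP h)

theorem eval_mem_of_coeff_mem {R : Type*} [CommRing R] (S : Subring R) {h : R[X]}
    (hc : ∀ i, h.coeff i ∈ S) {u : R} (hu : u ∈ S) : h.eval u ∈ S := by
  rw [eval_eq_sum_range]
  exact sum_mem fun i _ => mul_mem (hc i) (pow_mem hu i)

/-- Fixed coefficients have no poles on the orbit, so `h(s⁻¹)` can have one only at `P 0`. Hence `a`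
is regular on the whole orbit, and then so is `h(s⁻¹)`, which is impossible if `h` has positive
degree. -/
theorem natDegree_eq_zero_of_mapCoeff_add (hP : Function.Injective P)
    (hψ : ∀ m, ψ (P m) = P (m + 1)) (a : RatFunc K) (h : (RatFunc K)[X])
    (hh : h.map (mapCoeff ψ) = h)
    (ha : mapCoeff ψ a + h.eval (algebraMap K[X] (RatFunc K) (X - C (P 0)))⁻¹ = a) :
    h.natDegree = 0 := by
  set s := algebraMap K[X] (RatFunc K) (X - C (P 0)) with hs
  have hs0 : s ≠ 0 := RatFunc.algebraMap_ne_zero (X_sub_C_ne_zero _)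
  have hc : ∀ i, mapCoeff ψ (h.coeff i) = h.coeff i := fun i => by
    rw [← Polynomial.coeff_map, hh]
  have hreg : ∀ m, a ∈ regularAt (P m) := by
    refine mem_regularAt_of_orbit hP fun m hm => ?_
    have hu : h.eval s⁻¹ ∈ regularAt (P m) :=
      eval_mem_of_coeff_mem _ (fun i => mem_regularAt_of_mapCoeff_eq hP hψ (hc i) m)
        (inv_X_sub_C_mem_regularAt hP hm)
    rw [← mem_regularAt_succ_iff hψ]
    conv_rhs => rw [← ha]
    exact (add_mem_cancel_right hu).symm
  have hu : h.eval s⁻¹ ∈ regularAt (P 0) := by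
    rw [← eq_sub_iff_add_eq'] at ha
    rw [ha]
    exact sub_mem (hreg 0) ((mem_regularAt_succ_iff hψ 0).2 (hreg _))
  by_contra hdeg
  obtain ⟨N, hN⟩ := Nat.exists_eq_succ_of_ne_zero hdeg
  have hlc : h.leadingCoeff ≠ 0 := by
    rw [Ne, leadingCoeff_eq_zero]
    rintro rfl
    exact hdeg natDegree_zero
  have hlcinv : h.leadingCoeff⁻¹ ∈ regularAt (P 0) :=
    mem_regularAt_of_mapCoeff_eq hP hψ (by rw [map_inv₀, leadingCoeff, hc]) 0
  -- Here `deg h = N + 1`: multiplying by `s ^ N` leaves a simple pole `s⁻¹` plus a regular part.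
  have hsum : h.leadingCoeff⁻¹ * s ^ N * h.eval s⁻¹ =
      h.leadingCoeff⁻¹ * (∑ i ∈ Finset.range (N + 1), h.coeff i * s ^ (N - i)) + s⁻¹ := by
    rw [eval_eq_sum_range, hN, Finset.sum_range_succ, mul_add, mul_assoc, Finset.mul_sum]
    congr 1
    · congr 1
      refine Finset.sum_congr rfl fun i hi => ?_
      have : s ^ N = s ^ (N - i) * s ^ i := by
        rw [← pow_add, Nat.sub_add_cancel (Nat.lt_succ_iff.1 (Finset.mem_range.1 hi))]
      rw [this, inv_pow]
      field_simp
    · rw [← Nat.succ_eq_add_one, ← hN, coeff_natDegree, hN, inv_pow, pow_succ]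
      field_simp
  refine inv_X_sub_C_notMem_regularAt (P 0) ?_
  rw [← hs, ← add_sub_cancel_left (h.leadingCoeff⁻¹ *
    (∑ i ∈ Finset.range (N + 1), h.coeff i * s ^ (N - i))) s⁻¹, ← hsum]
  have hsreg : s ∈ regularAt (P 0) := X_sub_C_mem_regularAt _ _
  refine sub_mem (mul_mem (mul_mem hlcinv (pow_mem hsreg _)) hu) (mul_mem hlcinv ?_)
  exact sum_mem fun i _ => mul_mem (mem_regularAt_of_mapCoeff_eq hP hψ (hc i) 0) (pow_mem hsreg _)

/-- If `i < j`, then `c^ψ = s^(d+1) c` with `d ≥ 0`. Away from `P 0` the factor `s` is a unit, so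
`c` and `c⁻¹` are both regular on the orbit; then `s⁻¹ = s^d c / c^ψ` would be regular at `P 0`. -/
theorem le_of_pow_mul_mapCoeff_eq (hP : Function.Injective P) (hψ : ∀ m, ψ (P m) = P (m + 1))
    {c : RatFunc K} (hc : c ≠ 0) {i j : ℕ}
    (h : algebraMap K[X] (RatFunc K) (X - C (P 0)) ^ i * mapCoeff ψ c =
      algebraMap K[X] (RatFunc K) (X - C (P 0)) ^ j * c) : j ≤ i := by
  set s := algebraMap K[X] (RatFunc K) (X - C (P 0)) with hs
  have hs0 : s ≠ 0 := RatFunc.algebraMap_ne_zero (X_sub_C_ne_zero _)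
  by_contra! hij
  obtain ⟨d, rfl⟩ := Nat.exists_eq_add_of_lt hij
  have h1 : mapCoeff ψ c = s ^ (d + 1) * c := by
    refine mul_left_cancel₀ (pow_ne_zero i hs0) (h.trans ?_)
    rw [← mul_assoc, ← pow_add]
    rfl
  have hsreg : ∀ m, s ∈ regularAt (P m) := fun m => X_sub_C_mem_regularAt _ _
  have hinv : ∀ m, c⁻¹ ∈ regularAt (P m) := by
    refine mem_regularAt_of_orbit hP fun m hm => ?_
    have hu : s⁻¹ ∈ regularAt (P m) := inv_X_sub_C_mem_regularAt hP hm
    rw [← mem_regularAt_succ_iff hψ, map_inv₀, h1, mul_inv, ← inv_pow]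
    refine ⟨fun h => ?_, fun h => mul_mem (pow_mem hu _) h⟩
    have := mul_mem (pow_mem (hsreg m) (d + 1)) h
    rwa [← mul_assoc, ← mul_pow, mul_inv_cancel₀ hs0, one_pow, one_mul] at this
  have hreg : ∀ m, c ∈ regularAt (P m) := by
    refine mem_regularAt_of_orbit hP fun m hm => ?_
    have hu : s⁻¹ ∈ regularAt (P m) := inv_X_sub_C_mem_regularAt hP hm
    rw [← mem_regularAt_succ_iff hψ, h1]
    refine ⟨fun h => ?_, fun h => mul_mem (pow_mem (hsreg m) _) h⟩
    have := mul_mem (pow_mem hu (d + 1)) h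
    rwa [← mul_assoc, ← mul_pow, inv_mul_cancel₀ hs0, one_pow, one_mul] at this
  refine inv_X_sub_C_notMem_regularAt (P 0) ?_
  have h2 : s⁻¹ = s ^ d * c * (mapCoeff ψ c)⁻¹ := by
    rw [h1, pow_succ]
    field_simp
  rw [← hs, h2, ← map_inv₀]
  exact mul_mem (mul_mem (pow_mem (hsreg 0) _) (hreg 0))
    ((mem_regularAt_succ_iff hψ 0).2 (hinv _))

theorem eq_of_pow_mul_mapCoeff_eq (hP : Function.Injective P) (hψ : ∀ m, ψ (P m) = P (m + 1))
    {c : RatFunc K} (hc : c ≠ 0) {i j : ℕ}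
    (h : algebraMap K[X] (RatFunc K) (X - C (P 0)) ^ i * mapCoeff ψ c =
      algebraMap K[X] (RatFunc K) (X - C (P 0)) ^ j * c) : i = j := by
  refine le_antisymm (le_of_pow_mul_mapCoeff_eq hP hψ (inv_ne_zero hc) ?_)
    (le_of_pow_mul_mapCoeff_eq hP hψ hc h)
  have hc' : mapCoeff ψ c ≠ 0 := (_root_.map_ne_zero _).2 hc
  rw [map_inv₀]
  field_simp
  rw [mul_comm (mapCoeff ψ c)]
  exact h.symm

theorem infinite_fixed_mapCoeff (ψ : K →+* K) : {c : RatFunc K | mapCoeff ψ c = c}.Infinite := by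
  refine Set.infinite_of_injective_forall_mem
    (f := fun n : ℕ => algebraMap K[X] (RatFunc K) (X ^ n)) (fun m n h => ?_) fun n => ?_
  · have := congrArg natDegree (RatFunc.algebraMap_injective K h)
    simpa using this
  · rw [Set.mem_ofPred_eq, mapCoeff_algebraMap, Polynomial.map_pow, map_X]

end TwistedShift

end

/-! ### Laurent series, hyperderivatives and the difference equation -/

noncomputable section

namespace TwistedShift

open Polynomial

theorem algebraicIndependent_subfield {k M ι : Type*} [Field k] [Field M] [Algebra k M]
    {x : ι → M} (hx : AlgebraicIndependent k x) (L : Subfield M)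
    (hL : L ≤ (algebraMap k M).fieldRange) : AlgebraicIndependent L x := by
  let e := (algebraMap k M).rangeRestrictField
  have he : Function.Bijective e :=
    ⟨e.injective, fun ⟨_, c, hc⟩ => ⟨c, Subtype.ext hc⟩⟩
  let i : L →+* k := ((RingEquiv.ofBijective e he).symm : _ →+* k).comp (Subfield.inclusion hL)
  have hi : (algebraMap k M).comp i = algebraMap L M := by
    ext c
    exact congrArg Subtype.val ((RingEquiv.ofBijective e he).apply_symm_apply _)
  rw [algebraicIndependent_iff] at hx ⊢
  intro p hp
  have h1 : MvPolynomial.map i p = 0 := by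
    refine hx _ ?_
    rw [MvPolynomial.aeval_def, MvPolynomial.eval₂_map, hi]
    exact hp
  exact (map_eq_zero_iff _ (MvPolynomial.map_injective i i.injective)).1 h1

variable {K : Type*} [Field K]

/-- The endomorphism of `K((t))` acting by `ψ` on coefficients. -/
def mapLaurent (ψ : K →+* K) : LaurentSeries K →+* LaurentSeries K where
  toFun f := f.map ψ
  map_one' := by
    have := HahnSeries.map_C (Γ := ℤ) (1 : K) ψ
    rwa [map_one, map_one] at this
  map_mul' x y := HahnSeries.map_mul (ψ : K →ₙ+* K)
  map_zero' := by ext; simp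
  map_add' x y := by ext; simp

@[simp]
theorem mapLaurent_coeff (ψ : K →+* K) (f : LaurentSeries K) (n : ℤ) :
    (mapLaurent ψ f).coeff n = ψ (f.coeff n) := rfl

theorem mapLaurent_ofPowerSeries (ψ : K →+* K) (f : PowerSeries K) :
    mapLaurent ψ (HahnSeries.ofPowerSeries ℤ K f) =
      HahnSeries.ofPowerSeries ℤ K (PowerSeries.map ψ f) := by
  ext n
  rw [mapLaurent_coeff, PowerSeries.coeff_coe, PowerSeries.coeff_coe]
  split_ifs <;> simp

theorem mapLaurent_hasseDeriv (ψ : K →+* K) (n : ℕ) (f : LaurentSeries K) :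
    mapLaurent ψ (LaurentSeries.hasseDeriv K n f) =
      LaurentSeries.hasseDeriv K n (mapLaurent ψ f) := by
  ext m
  simp

/-- The Leibniz rule, in which only `∂^(0)` and `∂^(1)` of `t - a` survive; on coefficients it is
Pascal's rule, valid for integer upper index. -/
theorem hasseDeriv_X_sub_C_mul (a : K) (n : ℕ) (f : LaurentSeries K) :
    LaurentSeries.hasseDeriv K n ((HahnSeries.single 1 1 - HahnSeries.C a) * f) =
      (HahnSeries.single 1 1 - HahnSeries.C a) * LaurentSeries.hasseDeriv K n f +
        shiftSeq (fun i => LaurentSeries.hasseDeriv K i f) n := by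
  ext m
  cases n with
  | zero => simp [shiftSeq]
  | succ n =>
    have h := Ring.choose_succ_succ (m + n) n
    have h1 : m - 1 + ((n + 1 : ℕ) : ℤ) = m + n := by push_cast; ring
    have h2 : m + ((n + 1 : ℕ) : ℤ) = m + n + 1 := by push_cast; ring
    simp only [sub_mul, map_sub, HahnSeries.coeff_sub, HahnSeries.coeff_add, shiftSeq,
      LaurentSeries.hasseDeriv_coeff, HahnSeries.coeff_single_mul, HahnSeries.C_mul_eq_smul,
      HahnSeries.coeff_smul, one_mul, h1, h2, add_sub_cancel_right, h, add_smul, smul_eq_mul,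
      zsmul_eq_mul]
    ring

/-- The embedding of `K(t)` into `K((t))`. -/
def ratFuncToLaurent (K : Type*) [Field K] : RatFunc K →+* LaurentSeries K :=
  RatFunc.liftRingHom (algebraMap K[X] (LaurentSeries K))
    (nonZeroDivisors_le_comap_nonZeroDivisors_of_injective _
      (Polynomial.algebraMap_hahnSeries_injective ℤ))

@[simp]
theorem ratFuncToLaurent_algebraMap (p : K[X]) :
    ratFuncToLaurent K (algebraMap K[X] (RatFunc K) p) =
      HahnSeries.ofPowerSeries ℤ K (p : PowerSeries K) := by
  rw [ratFuncToLaurent, RatFunc.liftRingHom_algebraMap]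
  rfl

theorem mapLaurent_ratFuncToLaurent (ψ : K →+* K) (r : RatFunc K) :
    mapLaurent ψ (ratFuncToLaurent K r) = ratFuncToLaurent K (mapCoeff ψ r) := by
  have : (mapLaurent ψ).comp (ratFuncToLaurent K) = (ratFuncToLaurent K).comp (mapCoeff ψ) := by
    refine IsLocalization.ringHom_ext (nonZeroDivisors K[X]) (RingHom.ext fun p => ?_)
    simp only [RingHom.comp_apply, mapCoeff_algebraMap, ratFuncToLaurent_algebraMap,
      mapLaurent_ofPowerSeries, Polynomial.polynomial_map_coe]
  exact RingHom.congr_fun this r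

/-- A solution of the difference equation `ω^ψ = (t - P 0) ω` is hypertranscendental over `K(t)`,
if the orbit of `P 0` under `ψ` is infinite in both directions. -/
theorem algebraicIndependent_hasseDeriv {ψ : K →+* K} {P : ℤ → K} (hP : Function.Injective P)
    (hψ : ∀ m, ψ (P m) = P (m + 1)) {ω : LaurentSeries K} (hω0 : ω ≠ 0)
    (hω : mapLaurent ψ ω = (HahnSeries.single 1 1 - HahnSeries.C (P 0)) * ω)
    (L : Subfield (LaurentSeries K)) (hL : L ≤ (ratFuncToLaurent K).fieldRange) :
    AlgebraicIndependent L fun n : ℕ => LaurentSeries.hasseDeriv K n ω := by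
  let := (ratFuncToLaurent K).toAlgebra
  refine algebraicIndependent_subfield (k := RatFunc K) ?_ L hL
  have hs : ratFuncToLaurent K (algebraMap K[X] (RatFunc K) (X - C (P 0))) =
      HahnSeries.single 1 1 - HahnSeries.C (P 0) := by
    rw [ratFuncToLaurent_algebraMap, Polynomial.coe_sub, Polynomial.coe_X, Polynomial.coe_C,
      map_sub, HahnSeries.ofPowerSeries_X, HahnSeries.ofPowerSeries_C]
  refine algebraicIndependent_of_twist (mapCoeff ψ) (mapLaurent ψ)
    (mapLaurent_ratFuncToLaurent ψ) (RatFunc.algebraMap_ne_zero (X_sub_C_ne_zero (P 0)))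
    (infinite_fixed_mapCoeff ψ) (natDegree_eq_zero_of_mapCoeff_add hP hψ)
    (fun c i j hc h => eq_of_pow_mul_mapCoeff_eq hP hψ hc h) _ ?_ fun n => ?_
  · simpa using hω0
  · rw [mapLaurent_hasseDeriv, hω, hasseDeriv_X_sub_C_mul]
    exact congrArg (fun z => z * _ + _) hs.symm

end TwistedShift

end

/-! ### The Frobenius orbit of `θ` and the functional equation of `ω` -/

noncomputable section

namespace AndersonThakur

open TwistedShift
open scoped PowerSeries.WithPiTopology

variable (F : Type*) [Field F] [Finite F]

theorem one_lt_card_real : (1 : ℝ) < Nat.card F := by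
  exact_mod_cast Finite.one_lt_card

theorem theta_ne_zero : theta F ≠ 0 := by
  rw [← norm_ne_zero_iff, norm_theta]
  exact (zero_lt_one.trans (one_lt_card_real F)).ne'

theorem charP_CInfty (p : ℕ) [CharP F p] : CharP (CInfty F) p :=
  charP_of_injective_ringHom
    ((algebraMap (RatFunc F) (CInfty F)).comp (algebraMap F (RatFunc F))).injective p

theorem charP_KInftyAlgCl (p : ℕ) [CharP F p] : CharP (KInftyAlgCl F) p :=
  ((algebraMap (KInftyAlgCl F) (CInfty F)).charP_iff
    (algebraMap (KInftyAlgCl F) (CInfty F)).injective p).2 (charP_CInfty F p)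

/-- The element `θ` of the algebraic closure of `K_∞`. -/
def thetaAlgCl : KInftyAlgCl F :=
  algebraMap (KInfty F) (KInftyAlgCl F)
    ((WithAbs.toAbs (absInfty F) RatFunc.X : WithAbs (absInfty F)) : KInfty F)

theorem algebraMap_thetaAlgCl :
    algebraMap (KInftyAlgCl F) (CInfty F) (thetaAlgCl F) = theta F := rfl

/-- The backward orbit exists because the algebraic closure of `K_∞` is perfect. Norms along the
orbit exceed `1` and are raised to the power `q` at each step, so they increase strictly. -/
theorem exists_frobenius_orbit : ∃ (ψ : CInfty F →+* CInfty F) (P : ℤ → CInfty F),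
    (∀ x, ψ x = x ^ Nat.card F) ∧ Function.Injective P ∧ (∀ m, ψ (P m) = P (m + 1)) ∧
      P 0 = theta F := by
  have := Fintype.ofFinite F
  obtain ⟨p, hchar⟩ := CharP.exists F
  obtain ⟨f, hp, hcard⟩ := FiniteField.card F p
  have hq : Nat.card F = p ^ (f : ℕ) := by rw [Nat.card_eq_fintype_card, hcard]
  have : Fact p.Prime := ⟨hp⟩
  have := charP_CInfty F p
  have := charP_KInftyAlgCl F p
  let e : RingAut (KInftyAlgCl F) := iterateFrobeniusEquiv (KInftyAlgCl F) p f
  let P : ℤ → CInfty F := fun m =>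
    algebraMap (KInftyAlgCl F) (CInfty F) ((e ^ m) (thetaAlgCl F))
  have hsucc : ∀ m, P m ^ Nat.card F = P (m + 1) := fun m => by
    simp only [P]
    rw [add_comm m 1, zpow_add, zpow_one, RingAut.mul_apply, ← map_pow, hq]
    rfl
  have h0 : P 0 = theta F := by simp [P, algebraMap_thetaAlgCl]
  have hn0 : ‖P 0‖ = Nat.card F := by rw [h0, norm_theta]
  have hns : ∀ m, ‖P m‖ ^ Nat.card F = ‖P (m + 1)‖ := fun m => by rw [← norm_pow, hsucc]
  have hq0 : Nat.card F ≠ 0 := Nat.card_pos.ne'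
  have hgt : ∀ m, 1 < ‖P m‖ := by
    intro m
    induction m using Int.induction_on with
    | zero => rw [hn0]; exact one_lt_card_real F
    | succ n ih => rw [← hns]; exact one_lt_pow₀ ih hq0
    | pred n ih =>
      have := hns (-n - 1)
      rw [sub_add_cancel] at this
      rw [← this] at ih
      exact (one_lt_pow_iff_of_nonneg (norm_nonneg _) hq0).1 ih
  have hmono : StrictMono fun m => ‖P m‖ := strictMono_int_of_lt_succ fun m => by
    rw [← hns]
    exact lt_self_pow₀ (hgt m) Finite.one_lt_card
  refine ⟨iterateFrobenius (CInfty F) p f, P, fun x => ?_, ?_, fun m => ?_, h0⟩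
  · rw [iterateFrobenius_def, hq]
  · exact fun a b h => hmono.injective (congrArg norm h)
  · rw [iterateFrobenius_def, ← hq, hsucc]

variable {F}

theorem continuous_powerSeries_map {ψ : CInfty F →+* CInfty F} (hψ : Continuous ψ) :
    Continuous (PowerSeries.map ψ) := by
  rw [continuous_iff_continuousAt]
  intro f
  rw [ContinuousAt, PowerSeries.WithPiTopology.tendsto_iff_coeff_tendsto]
  intro d
  simp only [PowerSeries.coeff_map]
  exact (hψ.comp (PowerSeries.WithPiTopology.continuous_coeff _ d)).continuousAt

theorem map_omegaFactor {ψ : CInfty F →+* CInfty F} (hψ : ∀ x, ψ x = x ^ Nat.card F) (j : ℕ) :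
    PowerSeries.map ψ (omegaFactor F j) = omegaFactor F (j + 1) := by
  rw [omegaFactor, omegaFactor, map_sub, map_one, map_mul, PowerSeries.map_C, PowerSeries.map_X,
    hψ, inv_pow, ← pow_mul, ← pow_succ]

/-- Frobenius is continuous, so it passes through the infinite product and moves each factor to the
next. -/
theorem omegaProduct_eq {ψ : CInfty F →+* CInfty F} (hψ : ∀ x, ψ x = x ^ Nat.card F) :
    omegaProduct F = omegaFactor F 1 * PowerSeries.map ψ (omegaProduct F) := by
  have hcont : Continuous ψ := by
    rw [show (ψ : CInfty F → CInfty F) = fun x => x ^ Nat.card F from funext hψ]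
    exact continuous_pow _
  have hmap := (multipliable_omegaFactor F).map (PowerSeries.map ψ)
    (continuous_powerSeries_map hcont)
  rw [omegaProduct, (multipliable_omegaFactor F).map_tprod _ (continuous_powerSeries_map hcont)]
  simp only [Function.comp_def, map_omegaFactor hψ] at hmap ⊢
  exact tprod_eq_zero_mul' hmap

theorem constantCoeff_omegaProduct : PowerSeries.constantCoeff (omegaProduct F) = 1 := by
  have hcont : Continuous (PowerSeries.constantCoeff (R := CInfty F)) := by
    have := PowerSeries.WithPiTopology.continuous_coeff (CInfty F) 0
    rwa [PowerSeries.coeff_zero_eq_constantCoeff] at this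
  rw [omegaProduct, (multipliable_omegaFactor F).map_tprod _ hcont]
  simp [omegaFactor]

theorem ne_zero_of_pow_eq {lam : CInfty F} (hlam : lam ^ (Nat.card F - 1) = -theta F) :
    lam ≠ 0 := by
  rintro rfl
  rw [zero_pow (Nat.sub_ne_zero_of_lt Finite.one_lt_card)] at hlam
  exact theta_ne_zero F (neg_eq_zero.1 hlam.symm)

theorem Omega_eq {lam : CInfty F} (hlam : lam ^ (Nat.card F - 1) = -theta F)
    {ψ : CInfty F →+* CInfty F} (hψ : ∀ x, ψ x = x ^ Nat.card F) :
    Omega lam = (PowerSeries.X - PowerSeries.C (theta F ^ Nat.card F)) *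
      PowerSeries.map ψ (Omega lam) := by
  have h0 := ne_zero_of_pow_eq hlam
  have hth : theta F ^ Nat.card F ≠ 0 := pow_ne_zero _ (theta_ne_zero F)
  have hq : Nat.card F - 1 + 1 = Nat.card F := Nat.sub_add_cancel Nat.card_pos
  have h1 : ψ lam = -theta F * lam := by
    rw [hψ, ← hlam, ← pow_succ, hq]
  have h2 : ψ (theta F) = theta F ^ Nat.card F := hψ _
  -- From `λ^q = -θ λ`. The scalar `-θ^q` turns the split-off factor `1 - t / θ^q` into `t - θ^q`.
  have h3 : (lam ^ Nat.card F)⁻¹ = -(theta F ^ Nat.card F) * ψ ((lam ^ Nat.card F)⁻¹) := by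
    rw [← hψ, h1, map_inv₀, map_mul, map_neg, h1, h2]
    field_simp [theta_ne_zero F]
  rw [Omega, map_mul, PowerSeries.map_C]
  conv_lhs => rw [h3, omegaProduct_eq hψ]
  rw [omegaFactor, pow_one]
  have h4 : (PowerSeries.X - PowerSeries.C (theta F ^ Nat.card F)) =
      PowerSeries.C (-(theta F ^ Nat.card F)) *
        (1 - PowerSeries.C ((theta F ^ Nat.card F)⁻¹) * PowerSeries.X) := by
    rw [mul_sub, ← mul_assoc, ← map_mul, neg_mul, mul_inv_cancel₀ hth]
    simp only [map_neg, map_one]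
    ring
  rw [h4, map_mul]
  ring

theorem tVar_sub_C_theta_ne_zero : tVar F - HahnSeries.C (theta F) ≠ 0 := fun h => by
  have := congrArg (fun f => HahnSeries.coeff f 1) h
  simp [tVar] at this

theorem omega_ne_zero {lam : CInfty F} (hlam : lam ^ (Nat.card F - 1) = -theta F) :
    omega lam ≠ 0 := by
  have h0 := ne_zero_of_pow_eq hlam
  refine inv_ne_zero (mul_ne_zero tVar_sub_C_theta_ne_zero ?_)
  rw [map_ne_zero_iff _ HahnSeries.ofPowerSeries_injective]
  intro h
  have := congrArg PowerSeries.constantCoeff h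
  rw [Omega, map_mul, constantCoeff_omegaProduct, map_zero, mul_one,
    PowerSeries.constantCoeff_C] at this
  exact inv_ne_zero (pow_ne_zero _ h0) this

theorem mapLaurent_omega {lam : CInfty F} (hlam : lam ^ (Nat.card F - 1) = -theta F)
    {ψ : CInfty F →+* CInfty F} (hψ : ∀ x, ψ x = x ^ Nat.card F) :
    mapLaurent ψ (omega lam) = (tVar F - HahnSeries.C (theta F)) * omega lam := by
  have h1 : mapLaurent ψ (tVar F - HahnSeries.C (theta F)) =
      tVar F - HahnSeries.C (theta F ^ Nat.card F) := by
    rw [map_sub]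
    congr 1
    · ext n
      by_cases h : n = 1 <;> simp [tVar, h]
    · rw [← hψ]
      exact HahnSeries.map_C _ _
  have h2 := congrArg (HahnSeries.ofPowerSeries ℤ (CInfty F)) (Omega_eq hlam hψ)
  rw [map_mul, map_sub, HahnSeries.ofPowerSeries_X, HahnSeries.ofPowerSeries_C] at h2
  rw [omega, map_inv₀, map_mul, h1, mapLaurent_ofPowerSeries, tVar, ← h2, mul_inv, ← mul_assoc,
    ← tVar, mul_inv_cancel₀ tVar_sub_C_theta_ne_zero, one_mul]

theorem KBarT_le_fieldRange : KBarT F ≤ (ratFuncToLaurent (CInfty F)).fieldRange := by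
  rw [Subfield.closure_le]
  rintro _ (⟨c, -, rfl⟩ | rfl)
  · exact ⟨algebraMap _ _ (Polynomial.C c), by
      rw [ratFuncToLaurent_algebraMap, Polynomial.coe_C, HahnSeries.ofPowerSeries_C]⟩
  · exact ⟨algebraMap _ _ Polynomial.X, by
      rw [ratFuncToLaurent_algebraMap, Polynomial.coe_X, HahnSeries.ofPowerSeries_X, tVar]⟩

end AndersonThakur

end

theorem theorem7p2 (F : Type*) [Field F] [Finite F] (lam : AndersonThakur.CInfty F)
    (hlam : lam ^ (Nat.card F - 1) = -AndersonThakur.theta F) :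
    AlgebraicIndependent (AndersonThakur.KBarT F)
      (fun n : ℕ => AndersonThakur.hyperderiv n (AndersonThakur.omega lam)) := by
  obtain ⟨ψ, P, hψ, hinj, hP, h0⟩ := AndersonThakur.exists_frobenius_orbit F
  refine TwistedShift.algebraicIndependent_hasseDeriv hinj hP
    (AndersonThakur.omega_ne_zero hlam) ?_ _ AndersonThakur.KBarT_le_fieldRange
  rw [AndersonThakur.mapLaurent_omega hlam hψ, h0]
  rfl
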